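/- Let $n,m\ge 0$ and $T\ge 1$ be integers, let $B_1,\dots,B_m$ be nonzero real symmetric positive semidefinite $n\times n$ matrices, and let $\gamma,\delta_L,\delta_U>0$. Write $\langle X,Y\rangle=\operatorname{tr}(XY)$, and for a real symmetric matrix $X$ and reals $a,b$ write $X\in[a,b]$ if $X-aI$ and $bI-X$ are positive semidefinite (i.e. all eigenvalues of $X$ lie in $[a,b]$). For given symmetric $X_L,X_U$, consider the system in the unknowns $(\alpha,j)$ $$\delta_U\ \ge\ \frac{\exp(\gamma\alpha\operatorname{tr}B_j)-1}{\operatorname{tr}B_j}\,\langle X_U,B_j\rangle,\qquad \delta_L\ \le\ \frac{1-\exp(-\gamma\alpha\operatorname{tr}B_j)}{\operatorname{tr}B_j}\,\langle X_L,B_j\rangle,\qquad \alpha\ge 0,\ j\in\{1,\dots,m\}.\tag{$*$}$$ Let $\alpha(t)\in\mathbb R$ and $j(t)\in\{1,\dots,m\}$ for $1\le t\le T$, let $$A(t)=\sum_{\tau=1}^t\alpha(\tau)B_{j(\tau)},\qquad W_U(t+1)=\exp(\gamma A(t)),\qquad W_L(t+1)=\exp(-\gamma A(t))\qquad(0\le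 t\le T),$$ and suppose that for every $1\le t\le T$ the pair $(\alpha(t),j(t))$ is a solution of $(*)$ with $$X_U=\frac{W_U(t)}{\operatorname{tr}W_U(t)},\qquad X_L=\frac{W_L(t)}{\operatorname{tr}W_L(t)}.$$ Then $\delta_L<1$ and $$\frac{A(T)}{T}\in\left[\frac{\log\big((1-\delta_L)^{-1}\big)}{\gamma}-\frac{\log n}{T\gamma},\ \ \frac{\log(1+\delta_U)}{\gamma}+\frac{\log n}{T\gamma}\right].$$ -/

import Mathlib

/-- The trace inner product `⟨X, Y⟩ = tr (X Y)` on real symmetric matrices. -/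
def traceInner {n : ℕ} (X Y : Matrix (Fin n) (Fin n) ℝ) : ℝ :=
  (X * Y).trace

/-- `X ∈ [a, b]` for a real symmetric matrix `X`: `a I ⪯ X ⪯ b I` in the Loewner order. -/
structure MatrixMemIcc {n : ℕ} (X : Matrix (Fin n) (Fin n) ℝ) (a b : ℝ) : Prop where
  symm : X.IsSymm
  lower : (X - a • (1 : Matrix (Fin n) (Fin n) ℝ)).PosSemidef
  upper : (b • (1 : Matrix (Fin n) (Fin n) ℝ) - X).PosSemidef

/-- `(α, j)` is a solution of the width-free oracle system for the matrices `B`, the parameters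
`γ, δL, δU`, and the given matrices `XL, XU`. -/
structure IsOracleSolution {n m : ℕ} (B : Fin m → Matrix (Fin n) (Fin n) ℝ) (γ δL δU : ℝ)
    (XL XU : Matrix (Fin n) (Fin n) ℝ) (α : ℝ) (j : Fin m) : Prop where
  upper : (Real.exp (γ * α * (B j).trace) - 1) / (B j).trace * traceInner XU (B j) ≤ δU
  lower : δL ≤ (1 - Real.exp (-(γ * α * (B j).trace))) / (B j).trace * traceInner XL (B j)
  nonneg : 0 ≤ α

open Matrix Filter Topology

/-! ### Trace inequalities for dyadic powers. -/

namespace Matrix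

/-! The potentials `tr exp(±γ A(t))` start at `n`. Golden–Thompson splits off the newest summand,
and the chord bound `exp(cB) ⪯ I + ((exp(c tr B) - 1) / tr B) B` makes its effect linear in `B`; the
oracle inequalities then say that each step multiplies the potentials by at most `1 + δU` and `1 -
δL`. After `T` steps the trace dominates the largest eigenvalue of the exponential, and logarithms
give both bounds. Golden–Thompson itself follows from `trace_pow_two_pow_le` and the Lie product
formula. -/

theorem trace_mul_pow_comm {ι : Type*} [Fintype ι] [DecidableEq ι] (A B : Matrix ι ι ℝ) (k : ℕ) :
    ((A * B) ^ k).trace = ((B * A) ^ k).trace := by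
  have h (k : ℕ) : (A * B) ^ k * A = A * (B * A) ^ k := by
    induction k with
    | zero => simp
    | succ k ih => rw [pow_succ', Matrix.mul_assoc, ih, pow_succ', Matrix.mul_assoc,
        Matrix.mul_assoc]
  cases k with
  | zero => simp
  | succ k => rw [pow_succ, ← Matrix.mul_assoc, h, Matrix.trace_mul_comm, ← Matrix.mul_assoc,
      ← pow_succ']

theorem trace_mul_transpose_self_nonneg {ι : Type*} [Fintype ι] (X : Matrix ι ι ℝ) :
    0 ≤ (X * Xᵀ).trace := by
  have := (posSemidef_self_mul_conjTranspose X).trace_nonneg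
  rwa [conjTranspose_eq_transpose_of_trivial] at this

theorem two_mul_trace_mul_transpose_le {ι : Type*} [Fintype ι] (X Y : Matrix ι ι ℝ) :
    2 * (X * Yᵀ).trace ≤ (X * Xᵀ).trace + (Y * Yᵀ).trace := by
  have h := trace_mul_transpose_self_nonneg (X - Y)
  have h2 : (Y * Xᵀ).trace = (X * Yᵀ).trace := by
    rw [← trace_transpose, transpose_mul, transpose_transpose]
  simp only [transpose_sub, sub_mul, mul_sub, trace_sub, h2] at h
  linarith

/-- The two claims feed each other in one induction. For the first, pass to `M²`, regroup cyclically
as `(MᵀM)(MMᵀ)`, apply the second claim and then `2 tr(XYᵀ) ≤ tr(XXᵀ) + tr(YYᵀ)`. For the second,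
take `M = PQ` in the first and regroup as `P²Q²`. -/
theorem trace_pow_two_pow_le {ι : Type*} [Fintype ι] [DecidableEq ι] (k : ℕ) :
    (∀ M : Matrix ι ι ℝ, (M ^ 2 ^ (k + 1)).trace ≤ ((M * Mᵀ) ^ 2 ^ k).trace) ∧
    (∀ P Q : Matrix ι ι ℝ, P.IsSymm → Q.IsSymm →
      ((P * Q) ^ 2 ^ k).trace ≤ (P ^ 2 ^ k * Q ^ 2 ^ k).trace) := by
  induction k with
  | zero =>
    refine ⟨fun M => ?_, fun P Q _ _ => by simp⟩
    have h := two_mul_trace_mul_transpose_le M Mᵀ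
    rw [transpose_transpose, Matrix.trace_mul_comm Mᵀ M] at h
    simp only [zero_add, pow_one, pow_zero, sq]
    linarith
  | succ k ih =>
    obtain ⟨ihS, ihG⟩ := ih
    have hsq (X : Matrix ι ι ℝ) : X ^ 2 ^ (k + 1) = (X * X) ^ 2 ^ k := by
      rw [← sq, ← pow_mul, pow_succ']
    refine ⟨fun M => ?_, fun P Q hP hQ => ?_⟩
    · have h1 := ihS (M * M)
      have h2 := ihG (Mᵀ * M) (M * Mᵀ) (isSymm_transpose_mul_self M) (isSymm_mul_transpose_self M)
      have h3 := two_mul_trace_mul_transpose_le ((Mᵀ * M) ^ 2 ^ k) ((M * Mᵀ) ^ 2 ^ k)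
      rw [((isSymm_mul_transpose_self M).pow _).eq, ((isSymm_transpose_mul_self M).pow _).eq,
        ← sq, ← sq, ← pow_mul, ← pow_mul, ← pow_succ, trace_mul_pow_comm Mᵀ M] at h3
      have h4 : ((M * M * (M * M)ᵀ) ^ 2 ^ k).trace = ((Mᵀ * M * (M * Mᵀ)) ^ 2 ^ k).trace := by
        rw [transpose_mul, Matrix.mul_assoc, trace_mul_pow_comm]
        simp only [Matrix.mul_assoc]
        rw [trace_mul_pow_comm]
        simp only [Matrix.mul_assoc]
        rw [trace_mul_pow_comm]
        simp only [Matrix.mul_assoc]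
      have h5 : M ^ 2 ^ (k + 1 + 1) = (M * M) ^ 2 ^ (k + 1) := by
        rw [← sq, ← pow_mul, ← pow_succ']
      rw [h5]
      linarith
    · calc _ ≤ ((P * Q * (P * Q)ᵀ) ^ 2 ^ k).trace := ihS _
        _ = (((P * P) * (Q * Q)) ^ 2 ^ k).trace := by
          rw [transpose_mul, hP.eq, hQ.eq, Matrix.mul_assoc, trace_mul_pow_comm P,
            trace_mul_pow_comm (P * P)]
          simp only [Matrix.mul_assoc]
        _ ≤ _ := by
          rw [hsq, hsq]
          refine ihG _ _ ?_ ?_ <;> rw [← sq]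
          exacts [hP.pow 2, hQ.pow 2]

/-! ### Spectral calculus for the exponential. -/

theorem IsHermitian.exists_eq_mul_diagonal_mul_transpose {ι : Type*} [Fintype ι] [DecidableEq ι]
    {H : Matrix ι ι ℝ} (hH : H.IsHermitian) :
    ∃ U : Matrix ι ι ℝ, U * Uᵀ = 1 ∧ Uᵀ * U = 1 ∧ H = U * diagonal hH.eigenvalues * Uᵀ := by
  have hc : ((star hH.eigenvectorUnitary : unitaryGroup ι ℝ) : Matrix ι ι ℝ)
      = (hH.eigenvectorUnitary : Matrix ι ι ℝ)ᵀ := by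
    rw [← conjTranspose_eq_transpose_of_trivial]; rfl
  refine ⟨hH.eigenvectorUnitary, ?_, ?_, ?_⟩
  · rw [← hc]; simp
  · rw [← hc]; simp
  · conv_lhs => rw [hH.spectral_theorem, Unitary.conjStarAlgAut_apply]
    rw [← hc]; rfl

theorem PosSemidef.trace_mul_nonneg {ι : Type*} [Fintype ι] {P Q : Matrix ι ι ℝ}
    (hP : P.PosSemidef) (hQ : Q.PosSemidef) : 0 ≤ (P * Q).trace := by
  classical
  obtain ⟨R, rfl⟩ : ∃ R : Matrix ι ι ℝ, Q = Rᴴ * R := by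
    obtain ⟨U, -, -, h⟩ := hQ.1.exists_eq_mul_diagonal_mul_transpose
    refine ⟨diagonal (fun i => √(hQ.1.eigenvalues i)) * Uᵀ, ?_⟩
    rw [conjTranspose_eq_transpose_of_trivial, transpose_mul, transpose_transpose,
      diagonal_transpose, Matrix.mul_assoc, ← Matrix.mul_assoc (diagonal _), diagonal_mul_diagonal,
      ← Matrix.mul_assoc]
    simpa only [Real.mul_self_sqrt (hQ.eigenvalues_nonneg _)] using h
  rw [← Matrix.mul_assoc, Matrix.trace_mul_comm, ← Matrix.mul_assoc]
  exact (hP.mul_mul_conjTranspose_same R).trace_nonneg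

theorem exp_mul_diagonal_mul_transpose {ι : Type*} [Fintype ι] [DecidableEq ι]
    {U : Matrix ι ι ℝ} (hU : U * Uᵀ = 1) (d : ι → ℝ) :
    NormedSpace.exp (U * diagonal d * Uᵀ) = U * diagonal (fun i => Real.exp (d i)) * Uᵀ := by
  rw [← Matrix.inv_eq_right_inv hU, Matrix.exp_conj _ _ (.of_mul_eq_one _ hU), Matrix.exp_diagonal]
  congr 3
  ext i
  rw [Pi.coe_exp, Real.exp_eq_exp_ℝ]

theorem mul_diagonal_mul_transpose_posSemidef {ι : Type*} [Fintype ι] [DecidableEq ι]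
    (U : Matrix ι ι ℝ) {d : ι → ℝ} (hd : ∀ i, 0 ≤ d i) : (U * diagonal d * Uᵀ).PosSemidef := by
  rw [← conjTranspose_eq_transpose_of_trivial]
  exact (posSemidef_diagonal_iff.2 hd).mul_mul_conjTranspose_same U

theorem trace_mul_diagonal_mul_transpose {ι : Type*} [Fintype ι] [DecidableEq ι]
    {U : Matrix ι ι ℝ} (hU : Uᵀ * U = 1) (d : ι → ℝ) :
    (U * diagonal d * Uᵀ).trace = ∑ i, d i := by
  rw [Matrix.trace_mul_comm, ← Matrix.mul_assoc, hU, Matrix.one_mul, trace_diagonal]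

theorem IsHermitian.posSemidef_exp {ι : Type*} [Fintype ι] [DecidableEq ι]
    {H : Matrix ι ι ℝ} (hH : H.IsHermitian) : (NormedSpace.exp H).PosSemidef := by
  obtain ⟨U, hU, -, h⟩ := hH.exists_eq_mul_diagonal_mul_transpose
  rw [h, exp_mul_diagonal_mul_transpose hU]
  exact mul_diagonal_mul_transpose_posSemidef U fun i => (Real.exp_pos _).le

theorem IsHermitian.trace_exp_pos {ι : Type*} [Fintype ι] [DecidableEq ι] [Nonempty ι]
    {H : Matrix ι ι ℝ} (hH : H.IsHermitian) : 0 < (NormedSpace.exp H).trace := by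
  obtain ⟨U, hU, hU', h⟩ := hH.exists_eq_mul_diagonal_mul_transpose
  rw [h, exp_mul_diagonal_mul_transpose hU, trace_mul_diagonal_mul_transpose hU']
  exact Finset.sum_pos (fun i _ => Real.exp_pos _) Finset.univ_nonempty

theorem IsHermitian.posSemidef_smul_one_sub_of_trace_exp_le {ι : Type*} [Fintype ι]
    [DecidableEq ι] {H : Matrix ι ι ℝ} (hH : H.IsHermitian) {r : ℝ}
    (hr : (NormedSpace.exp H).trace ≤ Real.exp r) :
    (r • (1 : Matrix ι ι ℝ) - H).PosSemidef := by
  obtain ⟨U, hU, hU', h⟩ := hH.exists_eq_mul_diagonal_mul_transpose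
  rw [h, exp_mul_diagonal_mul_transpose hU, trace_mul_diagonal_mul_transpose hU'] at hr
  have hle (i : ι) : hH.eigenvalues i ≤ r := by
    rw [← Real.exp_le_exp]
    exact (Finset.single_le_sum (f := fun i => Real.exp (hH.eigenvalues i))
      (fun i _ => (Real.exp_pos _).le) (Finset.mem_univ i)).trans hr
  have h1 : r • (1 : Matrix ι ι ℝ) - H
      = U * diagonal (fun i => r - hH.eigenvalues i) * Uᵀ := by
    conv_lhs => rw [h, ← hU]
    have : diagonal (fun i => r - hH.eigenvalues i)
        = r • (1 : Matrix ι ι ℝ) - diagonal hH.eigenvalues := by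
      rw [smul_one_eq_diagonal, diagonal_sub]
    rw [this]
    simp [Matrix.mul_sub, Matrix.sub_mul]
  rw [h1]
  exact mul_diagonal_mul_transpose_posSemidef U fun i => sub_nonneg.2 (hle i)

/-- The eigenvalues of `B` lie in `[0, tr B]`, where the convex function `x ↦ exp(cx)` stays below
its chord; `c` may have either sign. -/
theorem PosSemidef.posSemidef_chord_sub_exp {ι : Type*} [Fintype ι] [DecidableEq ι]
    {B : Matrix ι ι ℝ} (hB : B.PosSemidef) (hB0 : B ≠ 0) (c : ℝ) :
    (1 + ((Real.exp (c * B.trace) - 1) / B.trace) • B - NormedSpace.exp (c • B)).PosSemidef := by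
  have htr : 0 < B.trace := hB.trace_nonneg.lt_of_ne' (mt hB.trace_eq_zero_iff.1 hB0)
  obtain ⟨U, hU, hU', h⟩ := hB.1.exists_eq_mul_diagonal_mul_transpose
  set d := hB.1.eigenvalues with hd
  have hd0 (i : ι) : 0 ≤ d i := hB.eigenvalues_nonneg i
  have htd : B.trace = ∑ i, d i := by rw [h, trace_mul_diagonal_mul_transpose hU']
  have hle (i : ι) : d i ≤ B.trace :=
    htd ▸ Finset.single_le_sum (fun i _ => hd0 i) (Finset.mem_univ i)
  generalize B.trace = b at htr hle ⊢
  have hc : c • B = U * diagonal (fun i => c * d i) * Uᵀ := by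
    rw [h]
    have : diagonal (fun i => c * d i) = c • diagonal d := by rw [← diagonal_smul]; rfl
    rw [this]; simp
  have h1 : 1 + ((Real.exp (c * b) - 1) / b) • B - NormedSpace.exp (c • B)
      = U * diagonal (fun i => 1 + (Real.exp (c * b) - 1) / b * d i - Real.exp (c * d i)) * Uᵀ := by
    rw [hc, exp_mul_diagonal_mul_transpose hU]
    have : diagonal (fun i => 1 + (Real.exp (c * b) - 1) / b * d i - Real.exp (c * d i))
        = 1 + ((Real.exp (c * b) - 1) / b) • diagonal d
          - diagonal (fun i => Real.exp (c * d i)) := by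
      rw [← diagonal_one, ← diagonal_smul, diagonal_add, diagonal_sub]; rfl
    rw [this]
    conv_lhs => rw [h, ← hU]
    simp [Matrix.mul_sub, Matrix.sub_mul, Matrix.mul_add, Matrix.add_mul]
  rw [h1]
  refine mul_diagonal_mul_transpose_posSemidef U fun i => sub_nonneg.2 ?_
  have hx := convexOn_exp.2 (Set.mem_univ 0) (Set.mem_univ (c * b))
    (sub_nonneg.2 ((div_le_one htr).2 (hle i))) (div_nonneg (hd0 i) htr.le) (by ring)
  simp only [smul_eq_mul, mul_zero, zero_add, Real.exp_zero, mul_one] at hx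
  have e1 : d i / b * (c * b) = c * d i := by field_simp
  rw [e1] at hx
  refine hx.trans (le_of_eq ?_)
  field_simp
  ring

end Matrix

/-! ### The Lie product formula. -/

theorem NormedSpace.norm_exp_le_exp_norm {R : Type*} [NormedRing R] [NormOneClass R]
    [NormedAlgebra ℝ R] [CompleteSpace R] (x : R) : ‖NormedSpace.exp x‖ ≤ Real.exp ‖x‖ := by
  rw [congrFun (NormedSpace.exp_eq_tsum ℝ) x]
  have h := NormedSpace.exp_series_hasSum_exp' (𝕂 := ℝ) ‖x‖
  rw [← Real.exp_eq_exp_ℝ] at h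
  refine tsum_of_norm_bounded h fun n => ?_
  rw [norm_smul, Real.norm_of_nonneg (by positivity), smul_eq_mul]
  gcongr
  exact norm_pow_le x n

theorem norm_pow_sub_pow_le_of_norm_le {R : Type*} [NormedRing R] [NormOneClass R] {x y : R} {M : ℝ}
    (hx : ‖x‖ ≤ M) (hy : ‖y‖ ≤ M) (N : ℕ) :
    ‖x ^ (N + 1) - y ^ (N + 1)‖ ≤ (N + 1) * M ^ N * ‖x - y‖ := by
  have hM : 0 ≤ M := (norm_nonneg x).trans hx
  induction N with
  | zero => simp
  | succ N ih =>
    have h : x ^ (N + 1 + 1) - y ^ (N + 1 + 1)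
        = x * (x ^ (N + 1) - y ^ (N + 1)) + (x - y) * y ^ (N + 1) := by
      rw [pow_succ' x (N + 1), pow_succ' y (N + 1)]; noncomm_ring
    rw [h]
    calc _ ≤ ‖x‖ * ‖x ^ (N + 1) - y ^ (N + 1)‖ + ‖x - y‖ * ‖y ^ (N + 1)‖ :=
          (norm_add_le _ _).trans (add_le_add (norm_mul_le _ _) (norm_mul_le _ _))
      _ ≤ M * ((N + 1) * M ^ N * ‖x - y‖) + ‖x - y‖ * M ^ (N + 1) := by
          gcongr
          exact (norm_pow_le y (N + 1)).trans (by gcongr)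
      _ = _ := by push_cast; ring

/-- The function `s ↦ exp(sa) exp(sb) - exp(s(a + b))` vanishes at `0` with zero derivative; these
are its difference quotients at `s = 1/N`. -/
theorem tendsto_smul_exp_mul_exp_sub {R : Type*} [NormedRing R] [NormedAlgebra ℝ R]
    [CompleteSpace R] (a b : R) :
    Tendsto (fun N : ℕ => (N : ℝ) •
      (NormedSpace.exp ((N : ℝ)⁻¹ • a) * NormedSpace.exp ((N : ℝ)⁻¹ • b)
        - NormedSpace.exp ((N : ℝ)⁻¹ • (a + b)))) atTop (𝓝 0) := by
  have h (c : R) := hasDerivAt_exp_smul_const (𝕂 := ℝ) c (0 : ℝ)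
  have hd := ((h a).mul (h b)).sub (h (a + b))
  simp only [zero_smul, NormedSpace.exp_zero, one_mul, mul_one, sub_self] at hd
  have hs := (hasDerivAt_iff_tendsto_slope_zero.1 hd).comp
    ((tendsto_nhdsWithin_iff.2 ⟨tendsto_inv_atTop_nhds_zero_nat (𝕜 := ℝ),
      (eventually_ne_atTop 0).mono fun N hN => by simpa using hN⟩))
  simpa [Function.comp_def] using hs

/-- The **Lie product formula**. -/
theorem tendsto_exp_mul_exp_pow {R : Type*} [NormedRing R] [NormOneClass R] [NormedAlgebra ℝ R]
    [CompleteSpace R] (a b : R) :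
    Tendsto (fun N : ℕ => (NormedSpace.exp ((N : ℝ)⁻¹ • a) * NormedSpace.exp ((N : ℝ)⁻¹ • b)) ^ N)
      atTop (𝓝 (NormedSpace.exp (a + b))) := by
  rw [tendsto_iff_norm_sub_tendsto_zero]
  have h := ((tendsto_smul_exp_mul_exp_sub a b).norm).const_mul (Real.exp (‖a‖ + ‖b‖))
  rw [norm_zero, mul_zero] at h
  refine squeeze_zero' (.of_forall fun _ => norm_nonneg _) ?_ h
  filter_upwards [eventually_ge_atTop 1] with N hN
  obtain ⟨K, rfl⟩ := Nat.exists_eq_add_of_le' hN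
  set t : ℝ := ((K + 1 : ℕ) : ℝ)⁻¹ with ht
  have ht0 : 0 < t := by positivity
  have hKt : ((K + 1 : ℕ) : ℝ) * t = 1 := mul_inv_cancel₀ (by positivity)
  have he : NormedSpace.exp (a + b) = NormedSpace.exp (t • (a + b)) ^ (K + 1) := by
    let _ : NormedAlgebra ℚ R := .restrictScalars ℚ ℝ R
    rw [← NormedSpace.exp_nsmul, ← Nat.cast_smul_eq_nsmul ℝ, smul_smul, hKt, one_smul]
  have hn (c : R) : ‖t • c‖ = t * ‖c‖ := by rw [norm_smul, Real.norm_of_nonneg ht0.le]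
  have h1 : ‖NormedSpace.exp (t • a) * NormedSpace.exp (t • b)‖
      ≤ Real.exp (t * (‖a‖ + ‖b‖)) := by
    rw [mul_add, Real.exp_add, ← hn, ← hn]
    exact (norm_mul_le _ _).trans (mul_le_mul (NormedSpace.norm_exp_le_exp_norm _)
      (NormedSpace.norm_exp_le_exp_norm _) (norm_nonneg _) (Real.exp_pos _).le)
  have h2 : ‖NormedSpace.exp (t • (a + b))‖ ≤ Real.exp (t * (‖a‖ + ‖b‖)) := by
    refine (NormedSpace.norm_exp_le_exp_norm _).trans (Real.exp_le_exp.2 ?_)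
    rw [hn]
    gcongr
    exact norm_add_le a b
  rw [he]
  -- Telescoping costs a factor `N = K + 1`, absorbed by the `o(1/N)` difference of the bases; the
  -- remaining `K` factors stay below `exp(‖a‖ + ‖b‖)`.
  refine (norm_pow_sub_pow_le_of_norm_le h1 h2 K).trans ?_
  rw [norm_smul, Real.norm_of_nonneg (by positivity), ← Real.exp_nat_mul]
  have h3 : Real.exp (K * (t * (‖a‖ + ‖b‖))) ≤ Real.exp (‖a‖ + ‖b‖) := by
    refine Real.exp_le_exp.2 ?_
    rw [← mul_assoc]
    refine mul_le_of_le_one_left (by positivity) ?_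
    push_cast at hKt
    linarith
  calc _ = Real.exp (K * (t * (‖a‖ + ‖b‖))) * (((K + 1 : ℕ) : ℝ) *
        ‖NormedSpace.exp (t • a) * NormedSpace.exp (t • b) - NormedSpace.exp (t • (a + b))‖) := by
        push_cast; ring
    _ ≤ _ := by gcongr

/-! ### Golden–Thompson and the one-step bound. -/

namespace Matrix

/-- The **Golden–Thompson inequality** for real symmetric matrices. -/
theorem trace_exp_add_le {ι : Type*} [Fintype ι] [DecidableEq ι] {A B : Matrix ι ι ℝ}
    (hA : A.IsSymm) (hB : B.IsSymm) :
    (NormedSpace.exp (A + B)).trace ≤ (NormedSpace.exp A * NormedSpace.exp B).trace := by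
  cases isEmpty_or_nonempty ι
  · simp [trace]
  let _ : NormedRing (Matrix ι ι ℝ) := Matrix.linftyOpNormedRing
  let _ : NormedAlgebra ℝ (Matrix ι ι ℝ) := Matrix.linftyOpNormedAlgebra
  have _ : NormOneClass (Matrix ι ι ℝ) := Matrix.linfty_opNormOneClass
  -- The subsequence `N = 2 ^ k` suffices, and there the dyadic trace inequality applies.
  have h := (tendsto_exp_mul_exp_pow A B).comp (tendsto_pow_atTop_atTop_of_one_lt one_lt_two)
  have hc : Continuous (trace : Matrix ι ι ℝ → ℝ) := continuous_id.matrix_trace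
  refine le_of_tendsto ((hc.tendsto _).comp h) (.of_forall fun k => ?_)
  have he (X : Matrix ι ι ℝ) :
      NormedSpace.exp (((2 ^ k : ℕ) : ℝ)⁻¹ • X) ^ 2 ^ k = NormedSpace.exp X := by
    rw [← Matrix.exp_nsmul, ← Nat.cast_smul_eq_nsmul ℝ, smul_smul,
      mul_inv_cancel₀ (by positivity), one_smul]
  refine ((trace_pow_two_pow_le k).2 _ _ (hA.smul _).exp (hB.smul _).exp).trans ?_
  rw [he, he]

/-- One multiplicative-weights step. -/
theorem PosSemidef.trace_exp_add_smul_le {ι : Type*} [Fintype ι] [DecidableEq ι]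
    {A B : Matrix ι ι ℝ} (hA : A.IsSymm) (hB : B.PosSemidef) (hB0 : B ≠ 0) (c : ℝ) :
    (NormedSpace.exp (A + c • B)).trace ≤ (NormedSpace.exp A).trace +
      (Real.exp (c * B.trace) - 1) / B.trace * (NormedSpace.exp A * B).trace := by
  have hBs : B.IsSymm := by simpa [IsHermitian, IsSymm] using hB.1
  have hAh : A.IsHermitian := by simpa [IsHermitian, IsSymm] using hA
  have h1 := trace_exp_add_le hA (hBs.smul c)
  have h2 := hAh.posSemidef_exp.trace_mul_nonneg (hB.posSemidef_chord_sub_exp hB0 c)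
  simp only [Matrix.mul_sub, Matrix.mul_add, Matrix.mul_one, trace_sub, trace_add,
    Matrix.mul_smul, trace_smul, smul_eq_mul] at h2
  linarith

end Matrix

/-! ### The potential argument. -/

theorem mainTheorem2 {n m : ℕ} (T : ℕ) (hT : 0 < T)
    (B : Fin m → Matrix (Fin n) (Fin n) ℝ)
    (hB : ∀ i, (B i).PosSemidef) (hB0 : ∀ i, B i ≠ 0)
    (γ δL δU : ℝ) (hγ : 0 < γ) (hδL : 0 < δL) (hδU : 0 < δU)
    (A WL WU : ℕ → Matrix (Fin n) (Fin n) ℝ) (α : ℕ → ℝ) (j : ℕ → Fin m)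
    (hA : ∀ t, t ≤ T → A t = ∑ τ ∈ Finset.Icc 1 t, α τ • B (j τ))
    (hWU : ∀ t, t ≤ T → WU (t + 1) = NormedSpace.exp (γ • A t))
    (hWL : ∀ t, t ≤ T → WL (t + 1) = NormedSpace.exp (-(γ • A t)))
    (hOracle : ∀ t, 1 ≤ t → t ≤ T →
      IsOracleSolution B γ δL δU ((WL t).trace⁻¹ • WL t) ((WU t).trace⁻¹ • WU t) (α t) (j t)) :
    δL < 1 ∧
    MatrixMemIcc ((T : ℝ)⁻¹ • A T)
      (Real.log ((1 - δL)⁻¹) / γ - Real.log n / (T * γ))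
      (Real.log (1 + δU) / γ + Real.log n / (T * γ)) := by
  have hBs (i : Fin m) : (B i).IsSymm := by simpa [IsHermitian, IsSymm] using (hB i).1
  have hAs (t : ℕ) (ht : t ≤ T) : (A t).IsSymm := by
    rw [hA t ht, IsSymm, transpose_sum]
    exact Finset.sum_congr rfl fun τ _ => (hBs _).smul _
  have hAsucc (t : ℕ) (ht : t + 1 ≤ T) : A (t + 1) = A t + α (t + 1) • B (j (t + 1)) := by
    rw [hA _ ht, hA t (by omega), Finset.sum_Icc_succ_top (by omega)]
  have hA0 : A 0 = 0 := by simp [hA 0 (Nat.zero_le _)]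
  -- `j` supplies an index, and no `0 × 0` matrix is nonzero.
  have hne : Nonempty (Fin n) := by
    by_contra h
    rw [not_nonempty_iff] at h
    exact hB0 (j 1) (Subsingleton.elim _ _)
  have hn : (0 : ℝ) < n := by
    have := Fin.pos_iff_nonempty.2 hne
    exact_mod_cast this
  have hexp_pos (c : ℝ) (t : ℕ) (ht : t ≤ T) : 0 < (NormedSpace.exp (c • A t)).trace :=
    IsHermitian.trace_exp_pos (by simpa [IsHermitian, IsSymm] using (hAs t ht).smul c)
  have hstep (c δ : ℝ) (t : ℕ) (ht : t + 1 ≤ T)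
      (h : (Real.exp (c * α (t + 1) * (B (j (t + 1))).trace) - 1) / (B (j (t + 1))).trace *
        traceInner ((NormedSpace.exp (c • A t)).trace⁻¹ • NormedSpace.exp (c • A t))
          (B (j (t + 1))) ≤ δ) :
      (NormedSpace.exp (c • A (t + 1))).trace ≤ (1 + δ) * (NormedSpace.exp (c • A t)).trace := by
    have hpos := hexp_pos c t (by omega)
    have h1 := PosSemidef.trace_exp_add_smul_le ((hAs t (by omega)).smul c) (hB (j (t + 1)))
      (hB0 _) (c * α (t + 1))
    rw [hAsucc t ht, smul_add, smul_smul]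
    rw [traceInner, Matrix.smul_mul, trace_smul, smul_eq_mul, mul_left_comm, inv_mul_le_iff₀ hpos]
      at h
    linarith
  have hU (t : ℕ) (ht : t + 1 ≤ T) := hstep γ δU t ht (by
    have h := (hOracle (t + 1) (by omega) ht).upper
    rwa [hWU t (by omega)] at h)
  -- The lower oracle inequality is the upper one with `(γ, δU)` replaced by `(-γ, -δL)`.
  have hL (t : ℕ) (ht : t + 1 ≤ T) := hstep (-γ) (-δL) t ht (by
    have h := (hOracle (t + 1) (by omega) ht).lower
    rw [hWL t (by omega), ← neg_smul, ← neg_mul, ← neg_mul] at h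
    rw [← neg_sub 1, neg_div, neg_mul]
    exact neg_le_neg h)
  -- Both traces in the first step are positive, so the factor `1 - δL` is too.
  have hδL1 : δL < 1 := by
    have h := (hexp_pos (-γ) 1 hT).trans_le (hL 0 hT)
    linarith [pos_of_mul_pos_left h (hexp_pos (-γ) 0 (by omega)).le]
  have hbound (c δ : ℝ) (hδ : 0 < 1 + δ) (h : ∀ t, t + 1 ≤ T →
      (NormedSpace.exp (c • A (t + 1))).trace ≤ (1 + δ) * (NormedSpace.exp (c • A t)).trace) :
      ((Real.log n + T * Real.log (1 + δ)) • (1 : Matrix (Fin n) (Fin n) ℝ)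
        - c • A T).PosSemidef := by
    have hpow : ∀ t ≤ T, (NormedSpace.exp (c • A t)).trace ≤ n * (1 + δ) ^ t := by
      intro t
      induction t with
      | zero => intro _; simp [hA0, NormedSpace.exp_zero]
      | succ t ih =>
        intro ht
        calc _ ≤ (1 + δ) * (n * (1 + δ) ^ t) :=
              (h t ht).trans (mul_le_mul_of_nonneg_left (ih (by omega)) hδ.le)
          _ = _ := by ring
    refine IsHermitian.posSemidef_smul_one_sub_of_trace_exp_le
      (by simpa [IsHermitian, IsSymm] using (hAs T le_rfl).smul c) ?_
    rw [Real.exp_add, Real.exp_log hn, Real.exp_nat_mul, Real.exp_log hδ]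
    exact hpow T le_rfl
  have hTpos : (0 : ℝ) < T := by exact_mod_cast hT
  have hscale : (0 : ℝ) ≤ (T * γ)⁻¹ := by positivity
  refine ⟨hδL1, (hAs T le_rfl).smul _, ?_, ?_⟩
  · have h := (hbound (-γ) (-δL) (by linarith) hL).smul hscale
    rw [smul_sub, smul_smul, smul_smul] at h
    have e1 : (T * γ)⁻¹ * (Real.log n + T * Real.log (1 + -δL))
        = -(Real.log ((1 - δL)⁻¹) / γ - Real.log n / (T * γ)) := by
      rw [Real.log_inv, ← sub_eq_add_neg]
      field_simp
      ring
    have e2 : (T * γ)⁻¹ * -γ = -(T : ℝ)⁻¹ := by field_simp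
    rwa [e1, e2, neg_smul, neg_smul, sub_neg_eq_add, neg_add_eq_sub] at h
  · have h := (hbound γ δU (by linarith) hU).smul hscale
    rw [smul_sub, smul_smul, smul_smul] at h
    convert h using 1
    congr 2 <;> field_simp
    ring
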